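/- **Theorem (two-level additive Schwarz method with neural network approximation).** Let $\Omega\subset\mathbb R^2$ be a nonempty bounded open set, $\Omega=\bigcup_{i=1}^N\Omega_i$ with open subdomains $\Omega_i$, $V=H_0^1(\Omega)$, $V_i=H_0^1(\Omega_i)\subset V$ (extension by zero), $V_0\subset V$ a closed subspace. Write $a(v,w)=\int_\Omega\nabla v\cdot\nabla w\,dx$, $|v|_1=a(v,v)^{1/2}$, $|v|_{1,\Omega_i}=\|\nabla v\|_{L^2(\Omega_i)}$, $\|\cdot\|_0$ for the norm of $L^2(\Omega)$, and let $C_p$ be the Poincaré constant of $\Omega$, i.e. the least $C_p\ge 0$ with $\|v\|_0\le C_p|v|_1$ for all $v\in V$. Let $s(x)=\{i\ge 1: x\in\Omega_i\}$, $N_c=\max_{x\in\Omega}|s(x)|$, $H=\max_i\operatorname{diam}\Omega_i$, and $0<\tau\le 1/N_c$. Let $f\in L^2(\Omega)$, $g\in H^1(\Omega)$, and let $u\in g+V$ be the weak solution of $-\Delta u=f$ in $\Omega$, $u=g$ on $\partial\Omega$. *Exact iteration.* For $z\in g+V$ let $w_i(z)\in z+V_i$ be the exact local solution, $a(w_i(z),v)=\int_\Omega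 fv\,dx$ for all $v\in V_i$, and $w_0(z)\in V_0$ the exact coarse correction, $a(w_0(z),v)=\int_\Omega fv\,dx-a(z,v)$ for all $v\in V_0$; put $T(z)=(1-N\tau)z+\tau\bigl(w_0(z)+\sum_{i=1}^N w_i(z)\bigr)$, and $u^{(n+1)}=T(u^{(n)})$. A number $C_2\ge 0$ is called an error reduction factor if $|u-T(z)|_1\le C_2|u-z|_1$ for all $z\in g+V$. *Network iteration.* Let $U^{(0)}=u^{(0)}\in g+V$ and $$U^{(n+1)}=(1-N\tau)U^{(n)}+\tau\Bigl(W_0(\cdot;\theta_0^{(n+1)})+\sum_{i=1}^N U_i^{(n+1)}\Bigr),$$ where $U_i^{(n+1)}=U_i(\cdot;\theta_i^{(n+1)})$ in $\Omega_i$ and $U_i^{(n+1)}=U^{(n)}$ in $\Omega\setminus\Omega_i$. Here $U_i(\cdot;\theta)$ and $W_0(\cdot;\theta)$ are arbitrary parametrized families of functions (neural networks), and the functions used satisfy the boundary conditions of the problems they approximate: $U_i^{(n+1)}-U^{(n)}\in V_i$ and $W_0(\cdot;\theta_0^{(n+1)})\in V$. The averaged output is $$\widehat U^{(n+1)}(x)=\frac1{|s(x)|}\Bigl(W_0(x;\theta_0^{(n+1)})+\sum_{i\in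 s(x)}U_i(x;\theta_i^{(n+1)})\Bigr).$$ *Assumptions.* 1. There is $C_0\ge0$ such that every $v\in V$ can be written as $v=\sum_{i=0}^N v_i$ with $v_i\in V_i$ and $\sum_{i=0}^N a(v_i,v_i)\le C_0\,a(v,v)$. 2. There are numbers $0\le\mathcal E_{ij}\le1$ $(1\le i,j\le N)$ with $a(v_i,v_j)\le\mathcal E_{ij}\,a(v_i,v_i)^{1/2}a(v_j,v_j)^{1/2}$ for all $v_i\in V_i$, $v_j\in V_j$. 3. For all $n$ and $i$: $|w_i(U^{(n)})-U_i^{(n+1)}|_{1,\Omega_i}\le\epsilon/N$ and $|w_0(U^{(n)})-W_0(\cdot;\theta_0^{(n+1)})|_1\le\epsilon_0$. 4. There is a constant $C$ such that for every $v\in V$ there is $v_0\in V_0$ with $\|v-v_0\|_0\le CH|v-v_0|_1$. *Conclusion.* The number $\bigl(1-\frac{2}{2+C_0}\tau+2(\|\mathcal E\|_2^2+1)\tau^2\bigr)^{1/2}$ is an error reduction factor; if $N_c\ge2$, there is an error reduction factor smaller than $1$; and for every error reduction factor $C_2<1$ and every $n\ge0$, $$\|u-\widehat U^{(n+1)}\|_0\le\frac{C_p}{\tau}\Bigl(|u-u^{(n+1)}|_1+|u-u^{(n)}|_1+\frac{2}{1-C_2}(\epsilon_0+\epsilon)\Bigr).$$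 -/

import Mathlib

open MeasureTheory Set
open scoped ENNReal ContDiff

noncomputable section

/-- The plane `ℝ²` with the Euclidean norm. -/
abbrev Plane : Type := EuclideanSpace ℝ (Fin 2)

/-- Pairs (function in `L²(Ω)`, vector field in `L²(Ω; ℝ²)`). A Sobolev function `v` on `Ω` is
represented by the pair `(v, ∇v)`. -/
abbrev L2Pair (Ω : Set Plane) : Type :=
  Lp ℝ 2 (volume.restrict Ω) × Lp Plane 2 (volume.restrict Ω)

/-- Smooth functions with compact support contained in `D`. -/
def IsTestFunction (D : Set Plane) (φ : Plane → ℝ) : Prop :=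
  ContDiff ℝ ∞ φ ∧ HasCompactSupport φ ∧ tsupport φ ⊆ D

/-- `H¹(Ω)`: the pairs `(v, G)` in which `G` is the weak gradient of `v` in `Ω`. -/
def H1 (Ω : Set Plane) : Set (L2Pair Ω) :=
  {p | ∀ φ : Plane → ℝ, IsTestFunction Ω φ →
    ∫ x in Ω, p.1 x • gradient φ x = - ∫ x in Ω, φ x • p.2 x}

/-- For `D ⊆ Ω`: the space `H¹₀(D)`, its elements being extended by zero to `Ω`, i.e. the
closure in the `H¹(Ω)` norm of the smooth functions with compact support in `D`. In particular
`H10 Ω Ω` is `H¹₀(Ω)`. -/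
def H10 (Ω D : Set Plane) : Submodule ℝ (L2Pair Ω) :=
  (Submodule.span ℝ {p : L2Pair Ω | ∃ φ : Plane → ℝ, IsTestFunction D φ ∧
    (p.1 : Plane → ℝ) =ᵐ[volume.restrict Ω] φ ∧
    (p.2 : Plane → Plane) =ᵐ[volume.restrict Ω] gradient φ}).topologicalClosure

/-- The bilinear form `a(v, w) = ∫_Ω ∇v · ∇w`. -/
def energyForm {Ω : Set Plane} (v w : L2Pair Ω) : ℝ :=
  ∫ x in Ω, inner ℝ (v.2 x) (w.2 x)

/-- The linear form `f(v) = ∫_Ω f v`. -/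
def loadForm {Ω : Set Plane} (f : Lp ℝ 2 (volume.restrict Ω)) (v : L2Pair Ω) : ℝ :=
  ∫ x in Ω, f x * v.1 x

/-- The seminorm `|v|_1 = a(v, v)^{1/2}`. -/
def h1Seminorm {Ω : Set Plane} (v : L2Pair Ω) : ℝ :=
  Real.sqrt (energyForm v v)

/-- The seminorm `|v|_{1,D} = (∫_D |∇v|²)^{1/2}` on a subdomain `D ⊆ Ω`. -/
def localH1Seminorm {Ω : Set Plane} (D : Set Plane) (v : L2Pair Ω) : ℝ :=
  Real.sqrt (∫ x in D, ‖v.2 x‖ ^ 2)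

/-- The norm `‖v‖_0` of `L²(Ω)`. -/
def l2Norm {Ω : Set Plane} (v : L2Pair Ω) : ℝ := ‖v.1‖

/-- The Poincaré constant of `Ω`: the smallest `C_p ≥ 0` such that `‖v‖_0 ≤ C_p |v|_1` for all
`v` in `H¹₀(Ω)`. -/
def poincareConst (Ω : Set Plane) : ℝ :=
  sInf {c : ℝ | 0 ≤ c ∧ ∀ v ∈ H10 Ω Ω, l2Norm v ≤ c * h1Seminorm v}

/-- `u` is the weak solution of `-Δu = f` in `Ω`, `u = g` on `∂Ω`. -/
structure IsWeakSolution {Ω : Set Plane} (f : Lp ℝ 2 (volume.restrict Ω)) (g u : L2Pair Ω) :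
    Prop where
  mem : u ∈ H1 Ω
  boundary : u - g ∈ H10 Ω Ω
  equation : ∀ v ∈ H10 Ω Ω, energyForm u v = loadForm f v

/-- `w` solves the local problem `-Δw = f` in `D`, `w = z` in `closure Ω \ D`. -/
structure IsLocalSolution {Ω : Set Plane} (f : Lp ℝ 2 (volume.restrict Ω)) (D : Set Plane)
    (z w : L2Pair Ω) : Prop where
  boundary : w - z ∈ H10 Ω D
  equation : ∀ v ∈ H10 Ω D, energyForm w v = loadForm f v

/-- `w` in `V₀` solves the coarse problem `-Δw = f + Δz` (tested with `V₀`). -/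
structure IsCoarseSolution {Ω : Set Plane} (f : Lp ℝ 2 (volume.restrict Ω))
    (V₀ : Submodule ℝ (L2Pair Ω)) (z w : L2Pair Ω) : Prop where
  mem : w ∈ V₀
  equation : ∀ v ∈ V₀, energyForm w v = loadForm f v - energyForm z v

/-- `D₁, …, D_N` is a decomposition of `Ω` into open, possibly overlapping subdomains. -/
structure IsSubdomainCover {N : ℕ} (Ω : Set Plane) (D : Fin N → Set Plane) : Prop where
  isOpen : ∀ i, IsOpen (D i)
  cover : ⋃ i, D i = Ω

open Classical in
/-- `s(x)`: the indices of the subdomains that contain `x`. -/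
def sharing {N : ℕ} (D : Fin N → Set Plane) (x : Plane) : Finset (Fin N) :=
  Finset.univ.filter fun i => x ∈ D i

/-- `N_c`: the maximal number of subdomains that share a point of `Ω`. -/
def maxOverlap {N : ℕ} (Ω : Set Plane) (D : Fin N → Set Plane) : ℕ :=
  sSup ((fun x => (sharing D x).card) '' Ω)

/-- The largest subdomain diameter `H`. -/
def maxDiam {N : ℕ} (D : Fin N → Set Plane) : ℝ :=
  ⨆ i, Metric.diam (D i)

/-- One step `z ↦ z'` of the two-level iteration in the Hilbert space:
`z' = (1 - N τ) z + τ (w₀ + ∑ᵢ wᵢ)`, with the exact coarse solution `w₀` and the exact local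
solutions `wᵢ` for the previous iterate `z`. -/
def IsExactStep {Ω : Set Plane} {N : ℕ} (f : Lp ℝ 2 (volume.restrict Ω))
    (D : Fin N → Set Plane) (V₀ : Submodule ℝ (L2Pair Ω)) (τ : ℝ) (z z' : L2Pair Ω) : Prop :=
  ∃ (w₀ : L2Pair Ω) (w : Fin N → L2Pair Ω),
    IsCoarseSolution f V₀ z w₀ ∧ (∀ i, IsLocalSolution f (D i) z (w i)) ∧
    z' = (1 - N * τ) • z + τ • (w₀ + ∑ i, w i)

/-- `C` is an error reduction factor of the exact two-level iteration for the solution `u`: one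
step from any admissible iterate `z` reduces the error `|u - z|_1` at least by the factor `C`. -/
def IsErrorReductionFactor {Ω : Set Plane} {N : ℕ} (f : Lp ℝ 2 (volume.restrict Ω))
    (D : Fin N → Set Plane) (V₀ : Submodule ℝ (L2Pair Ω)) (τ : ℝ) (u : L2Pair Ω) (C : ℝ) : Prop :=
  0 ≤ C ∧ ∀ z z' : L2Pair Ω, u - z ∈ H10 Ω Ω → IsExactStep f D V₀ τ z z' →
    h1Seminorm (u - z') ≤ C * h1Seminorm (u - z)

/-- The two-level iteration with network approximations. `Unet i` and `Wnet` are the parametrized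
families of functions `Uᵢ(·; θ)` and `W₀(·; θ)`, `θ n i` and `θ₀ n` the parameters found in
iteration `n`. `U n` is the global iterate, `Uloc n i` the local approximation, which is
`Uᵢ(·; θᵢ)` in `Dᵢ` and the previous iterate outside `Dᵢ`, and `W n` the coarse approximation.
The approximations fulfil the boundary conditions of the problems that they approximate. -/
structure IsNetworkIteration {Ω : Set Plane} {N : ℕ} (D : Fin N → Set Plane) (τ : ℝ)
    {Θ : Fin N → Type*} {Θ₀ : Type*} (Unet : (i : Fin N) → Θ i → Plane → ℝ)
    (Wnet : Θ₀ → Plane → ℝ) (θ : ℕ → (i : Fin N) → Θ i) (θ₀ : ℕ → Θ₀)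
    (U : ℕ → L2Pair Ω) (Uloc : ℕ → Fin N → L2Pair Ω) (W : ℕ → L2Pair Ω) : Prop where
  local_inside : ∀ n i, ((Uloc (n + 1) i).1 : Plane → ℝ) =ᵐ[volume.restrict (D i)]
    Unet i (θ (n + 1) i)
  local_outside : ∀ n i, ((Uloc (n + 1) i).1 : Plane → ℝ) =ᵐ[volume.restrict (Ω \ D i)] (U n).1
  local_boundary : ∀ n i, Uloc (n + 1) i - U n ∈ H10 Ω (D i)
  coarse_eq : ∀ n, ((W (n + 1)).1 : Plane → ℝ) =ᵐ[volume.restrict Ω] Wnet (θ₀ (n + 1))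
  coarse_boundary : ∀ n, W (n + 1) ∈ H10 Ω Ω
  step : ∀ n, U (n + 1) = (1 - N * τ) • U n + τ • (W (n + 1) + ∑ i, Uloc (n + 1) i)

/-- The averaged output `Û(x) = (1 / |s(x)|) (W₀(x) + ∑_{i ∈ s(x)} Uᵢ(x))`. -/
def averagedOutput {N : ℕ} (D : Fin N → Set Plane) (W₀ : Plane → ℝ) (Ui : Fin N → Plane → ℝ)
    (x : Plane) : ℝ :=
  1 / ((sharing D x).card : ℝ) * (W₀ x + ∑ i ∈ sharing D x, Ui i x)

/-- Stable decomposition with constant `C₀`, the coarse space being included. -/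
def StableDecomposition {Ω : Set Plane} {N : ℕ} (D : Fin N → Set Plane)
    (V₀ : Submodule ℝ (L2Pair Ω)) (C₀ : ℝ) : Prop :=
  ∀ v ∈ H10 Ω Ω, ∃ (v₀ : L2Pair Ω) (w : Fin N → L2Pair Ω),
    v₀ ∈ V₀ ∧ (∀ i, w i ∈ H10 Ω (D i)) ∧ v = v₀ + ∑ i, w i ∧
    energyForm v₀ v₀ + ∑ i, energyForm (w i) (w i) ≤ C₀ * energyForm v v

/-- Strengthened Cauchy-Schwarz inequalities between the local spaces. -/
def StrengthenedCauchySchwarz {N : ℕ} (Ω : Set Plane) (D : Fin N → Set Plane)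
    (E : Matrix (Fin N) (Fin N) ℝ) : Prop :=
  ∀ i j, 0 ≤ E i j ∧ E i j ≤ 1 ∧ ∀ v ∈ H10 Ω (D i), ∀ w ∈ H10 Ω (D j),
    energyForm v w ≤ E i j * Real.sqrt (energyForm v v) * Real.sqrt (energyForm w w)

/-- Approximation property of the coarse space, with constant `C`. -/
def CoarseApproximation {Ω : Set Plane} {N : ℕ} (D : Fin N → Set Plane)
    (V₀ : Submodule ℝ (L2Pair Ω)) (C : ℝ) : Prop :=
  ∀ v ∈ H10 Ω Ω, ∃ v₀ ∈ V₀, l2Norm (v - v₀) ≤ C * maxDiam D * h1Seminorm (v - v₀)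

/-- In every iteration the local approximations have an error of at most `ε / N` with respect to
the exact local solutions for the same previous iterate. -/
def LocalNetworkError {Ω : Set Plane} {N : ℕ} (f : Lp ℝ 2 (volume.restrict Ω))
    (D : Fin N → Set Plane) (U : ℕ → L2Pair Ω) (Uloc : ℕ → Fin N → L2Pair Ω) (ε : ℝ) : Prop :=
  ∀ n i, ∀ w : L2Pair Ω, IsLocalSolution f (D i) (U n) w →
    localH1Seminorm (D i) (w - Uloc (n + 1) i) ≤ ε / N

/-- In every iteration the coarse approximation has an error of at most `ε₀` with respect to the
exact coarse solution for the same previous iterate. -/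
def CoarseNetworkError {Ω : Set Plane} (f : Lp ℝ 2 (volume.restrict Ω))
    (V₀ : Submodule ℝ (L2Pair Ω)) (U W : ℕ → L2Pair Ω) (ε₀ : ℝ) : Prop :=
  ∀ n, ∀ w : L2Pair Ω, IsCoarseSolution f V₀ (U n) w → h1Seminorm (w - W (n + 1)) ≤ ε₀

/-- The 2-norm of a matrix. -/
def matrixTwoNorm {N : ℕ} (E : Matrix (Fin N) (Fin N) ℝ) : ℝ :=
  ‖Matrix.toEuclideanCLM (𝕜 := ℝ) E‖

/-- `R(τ) = 1 - 2 τ / (2 + C₀) + 2 (e² + 1) τ²`, where `e` is the 2-norm of the matrix in the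
strengthened Cauchy-Schwarz inequalities. -/
def reductionBound (C₀ e τ : ℝ) : ℝ :=
  1 - 2 / (2 + C₀) * τ + 2 * (e ^ 2 + 1) * τ ^ 2

end

/-! ### The energy form as an inner product of gradients -/

/-! For `e = u - z`, an exact step maps `e` to `e - τ q` with `q = (P₀ + ∑ Pᵢ) e`, the `P`'s being
energy projections, so `|e - τ q|² = |e|² - 2 τ a(e, q) + τ² |q|²` and `a(e, q) = |P₀ e|² + ∑ |Pᵢ
e|²`. Stable decomposition gives `|e|² ≤ C₀ a(e, q)` (`IsSchwarzCorrection.norm_sq_le_inner`). For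
`|q|²` there are two bounds: `2 (‖E‖² + 1) |e|²` from strengthened Cauchy-Schwarz, which yields the
explicit factor, and `(N_c + 1) a(e, q)` because almost every point sees at most `N_c` nonzero local
gradients. With `N_c ≥ 2` and `τ N_c ≤ 1` the second bound makes the step a strict contraction.

A network step is an exact step plus a perturbation of energy norm at most `τ (ε₀ + ε)`. The
contraction keeps the two iterations within the geometric sum `(ε₀ + ε) / (1 - C₂)`
(`IsNetworkIteration.norm_sub_le`).

At a point with `k = |s(x)|`, the subdomains missing `x` contribute the old iterate, and the update
reads `U⁽ⁿ⁺¹⁾ = (1 - k τ) U⁽ⁿ⁾ + k τ Û`. Solving for `Û` bounds `u - Û` pointwise by the errors of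
two successive iterates (`abs_sub_averaged_le`), to which the Poincaré inequality applies. -/

theorem energyForm_eq_inner {Ω : Set Plane} (v w : L2Pair Ω) :
    energyForm v w = inner ℝ v.2 w.2 := by
  rw [energyForm, L2.inner_def]

theorem h1Seminorm_eq_norm {Ω : Set Plane} (v : L2Pair Ω) : h1Seminorm v = ‖v.2‖ := by
  rw [h1Seminorm, energyForm_eq_inner, real_inner_self_eq_norm_sq, Real.sqrt_sq (norm_nonneg _)]

/-! ### Test functions -/

theorem IsTestFunction.add {D : Set Plane} {φ ψ : Plane → ℝ} (hφ : IsTestFunction D φ)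
    (hψ : IsTestFunction D ψ) : IsTestFunction D (φ + ψ) :=
  ⟨hφ.1.add hψ.1, hφ.2.1.add hψ.2.1,
    (tsupport_add φ ψ).trans (union_subset hφ.2.2 hψ.2.2)⟩

theorem IsTestFunction.const_smul {D : Set Plane} {φ : Plane → ℝ} (c : ℝ)
    (hφ : IsTestFunction D φ) : IsTestFunction D (c • φ) :=
  ⟨contDiff_const.smul hφ.1, hφ.2.1.smul_left (f := fun _ => c),
    (tsupport_smul_subset_right (fun _ => c) φ).trans hφ.2.2⟩

theorem IsTestFunction.zero (D : Set Plane) : IsTestFunction D 0 :=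
  ⟨contDiff_const, HasCompactSupport.zero, by simp [tsupport]⟩

theorem IsTestFunction.mono {D D' : Set Plane} (h : D ⊆ D') {φ : Plane → ℝ}
    (hφ : IsTestFunction D φ) : IsTestFunction D' φ :=
  ⟨hφ.1, hφ.2.1, hφ.2.2.trans h⟩

theorem IsTestFunction.differentiable {D : Set Plane} {φ : Plane → ℝ}
    (hφ : IsTestFunction D φ) : Differentiable ℝ φ :=
  hφ.1.differentiable (by simp)

theorem IsTestFunction.fderiv_eq_zero {D : Set Plane} {φ : Plane → ℝ} (hφ : IsTestFunction D φ)
    {x : Plane} (hx : x ∉ D) : fderiv ℝ φ x = 0 := by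
  by_contra h
  exact hx (hφ.2.2 (support_fderiv_subset ℝ h))

theorem IsTestFunction.gradient_eq_zero {D : Set Plane} {φ : Plane → ℝ}
    (hφ : IsTestFunction D φ) {x : Plane} (hx : x ∉ D) : gradient φ x = 0 := by
  rw [gradient, hφ.fderiv_eq_zero hx, map_zero]

/-- The pairs `(φ, ∇φ)` for test functions `φ` in `D`. -/
def testPairs (Ω D : Set Plane) : Submodule ℝ (L2Pair Ω) where
  carrier := {p : L2Pair Ω | ∃ φ : Plane → ℝ, IsTestFunction D φ ∧
    (p.1 : Plane → ℝ) =ᵐ[volume.restrict Ω] φ ∧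
    (p.2 : Plane → Plane) =ᵐ[volume.restrict Ω] gradient φ}
  zero_mem' := by
    refine ⟨0, .zero D, Lp.coeFn_zero _ _ _, ?_⟩
    refine (Lp.coeFn_zero _ _ _).trans (.of_eq ?_)
    ext1 x
    simp [gradient]
  add_mem' := by
    rintro p q ⟨φ, hφ, hp, hp'⟩ ⟨ψ, hψ, hq, hq'⟩
    refine ⟨φ + ψ, hφ.add hψ, (Lp.coeFn_add _ _).trans (hp.add hq),
      (Lp.coeFn_add _ _).trans ((hp'.add hq').trans (.of_eq ?_))⟩
    ext1 x
    simp [gradient, fderiv_add (hφ.differentiable x) (hψ.differentiable x)]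
  smul_mem' := by
    rintro c p ⟨φ, hφ, hp, hp'⟩
    refine ⟨c • φ, hφ.const_smul c, (Lp.coeFn_smul _ _).trans (hp.const_smul c),
      (Lp.coeFn_smul _ _).trans ((hp'.const_smul c).trans (.of_eq ?_))⟩
    ext1 x
    simp [gradient, fderiv_const_smul (hφ.differentiable x)]

/-- The generators already form a subspace, so any closed condition on `H10` need only be checked on
test functions. -/
theorem H10_eq_closure_testPairs (Ω D : Set Plane) :
    H10 Ω D = (testPairs Ω D).topologicalClosure :=
  congrArg _ (Submodule.span_eq (testPairs Ω D))

theorem isClosed_H10 (Ω D : Set Plane) : IsClosed (H10 Ω D : Set (L2Pair Ω)) :=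
  Submodule.isClosed_topologicalClosure _

theorem H10_mono (Ω : Set Plane) {D D' : Set Plane} (h : D ⊆ D') : H10 Ω D ≤ H10 Ω D' := by
  rw [H10_eq_closure_testPairs, H10_eq_closure_testPairs]
  refine Submodule.topologicalClosure_mono ?_
  rintro p ⟨φ, hφ, hp⟩
  exact ⟨φ, hφ.mono h, hp⟩

/-! ### The Poincaré inequality -/

/-- The Sobolev inequality `‖φ‖_{L²} ≤ K ‖φ'‖_{L¹}` in dimension two. -/
theorem exists_eLpNorm_two_le_eLpNorm_fderiv_one {F : Type*} [NormedAddCommGroup F]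
    [NormedSpace ℝ F] [FiniteDimensional ℝ F] [MeasurableSpace F] [BorelSpace F] (μ : Measure F)
    [μ.IsAddHaarMeasure] (hF : Module.finrank ℝ F = 2) :
    ∃ K : NNReal, ∀ (s : Set F) (φ : F → ℝ), ContDiff ℝ 1 φ → HasCompactSupport φ →
      Function.support (fderiv ℝ φ) ⊆ s →
      eLpNorm φ 2 μ ≤ K * eLpNorm (fderiv ℝ φ) 1 (μ.restrict s) := by
  have hconj : NNReal.HolderConjugate (Module.finrank ℝ F) 2 := by
    rw [hF, NNReal.holderConjugate_iff]
    norm_num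
  refine ⟨eLpNormLESNormFDerivOneConst μ (2 : NNReal), fun s φ hφ hφc hs => ?_⟩
  refine (eLpNorm_le_eLpNorm_fderiv_one μ hφ hφc hconj).trans_eq ?_
  rw [eLpNorm_one_eq_lintegral_enorm, eLpNorm_one_eq_lintegral_enorm,
    setLIntegral_eq_of_support_subset]
  intro x hx
  exact hs fun h => hx (by simp [← ofReal_norm, h])

/-- Sobolev bounds the `L²` norm by the `L¹` norm of the gradient on `Ω`; Cauchy-Schwarz then costs
the factor `|Ω|^{1/2}`. -/
theorem exists_eLpNorm_le_of_isTestFunction (Ω : Set Plane) :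
    ∃ K : NNReal, ∀ φ : Plane → ℝ, IsTestFunction Ω φ →
      eLpNorm φ 2 (volume.restrict Ω) ≤
        K * (eLpNorm (gradient φ) 2 (volume.restrict Ω) * volume Ω ^ (2⁻¹ : ℝ)) := by
  obtain ⟨K, hK⟩ := exists_eLpNorm_two_le_eLpNorm_fderiv_one (volume : Measure Plane)
    finrank_euclideanSpace_fin
  refine ⟨K, fun φ hφ => ?_⟩
  have hφ1 : ContDiff ℝ 1 φ := hφ.1.of_le (by exact_mod_cast le_top)
  have h2 : Function.support (fderiv ℝ φ) ⊆ Ω := fun x hx =>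
    not_not.1 fun h => hx (hφ.fderiv_eq_zero h)
  have h3 : eLpNorm (fderiv ℝ φ) 2 (volume.restrict Ω) =
      eLpNorm (gradient φ) 2 (volume.restrict Ω) := by
    refine eLpNorm_congr_norm_ae (.of_forall fun x => ?_)
    rw [gradient, LinearIsometryEquiv.norm_map]
  have h4 := eLpNorm_le_eLpNorm_mul_rpow_measure_univ (μ := volume.restrict Ω)
    (f := fderiv ℝ φ) (p := 1) (q := 2) (by norm_num)
    (hφ1.continuous_fderiv one_ne_zero).aestronglyMeasurable
  have h5 : (1 / (1 : ℝ≥0∞).toReal - 1 / (2 : ℝ≥0∞).toReal) = (2⁻¹ : ℝ) := by norm_num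
  rw [h5, h3, Measure.restrict_apply_univ] at h4
  calc eLpNorm φ 2 (volume.restrict Ω) ≤ eLpNorm φ 2 volume :=
        eLpNorm_mono_measure _ Measure.restrict_le_self
    _ ≤ _ := hK Ω φ hφ1 hφ.2.1 h2
    _ ≤ _ := by gcongr

theorem exists_poincare {Ω : Set Plane} (hΩb : Bornology.IsBounded Ω) :
    ∃ c : ℝ, 0 ≤ c ∧ ∀ v ∈ H10 Ω Ω, ‖v.1‖ ≤ c * ‖v.2‖ := by
  obtain ⟨K, hK⟩ := exists_eLpNorm_le_of_isTestFunction Ω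
  have hfin : volume Ω ^ (2⁻¹ : ℝ) ≠ ⊤ :=
    ENNReal.rpow_ne_top_of_nonneg (by norm_num) hΩb.measure_lt_top.ne
  refine ⟨K * (volume Ω ^ (2⁻¹ : ℝ)).toReal, by positivity, fun v hv => ?_⟩
  rw [H10_eq_closure_testPairs] at hv
  have hcl : IsClosed {v : L2Pair Ω | ‖v.1‖ ≤ K * (volume Ω ^ (2⁻¹ : ℝ)).toReal * ‖v.2‖} :=
    isClosed_le (by fun_prop) (by fun_prop)
  refine closure_minimal ?_ hcl hv
  rintro p ⟨φ, hφ, hp, hp'⟩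
  have h := hK φ hφ
  rw [← eLpNorm_congr_ae hp, ← eLpNorm_congr_ae hp'] at h
  have h' := ENNReal.toReal_mono (ENNReal.mul_ne_top ENNReal.coe_ne_top
    (ENNReal.mul_ne_top (Lp.eLpNorm_ne_top _) hfin)) h
  rw [ENNReal.toReal_mul, ENNReal.toReal_mul, ENNReal.coe_toReal, ← Lp.norm_def,
    ← Lp.norm_def, mul_comm ‖p.2‖, ← mul_assoc] at h'
  exact h'

theorem l2Norm_le_poincareConst_mul {Ω : Set Plane}
    (hΩb : Bornology.IsBounded Ω) {v : L2Pair Ω} (hv : v ∈ H10 Ω Ω) :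
    l2Norm v ≤ poincareConst Ω * h1Seminorm v := by
  obtain ⟨c, hc, hP⟩ := exists_poincare hΩb
  have hne : {c : ℝ | 0 ≤ c ∧ ∀ v ∈ H10 Ω Ω, l2Norm v ≤ c * h1Seminorm v}.Nonempty :=
    ⟨c, hc, fun v hv => by simpa [l2Norm, h1Seminorm_eq_norm] using hP v hv⟩
  have h0 : 0 ≤ h1Seminorm v := Real.sqrt_nonneg _
  -- If the gradient vanishes one cannot divide by it, but any admissible constant already forces
  -- `l2Norm v ≤ 0`.
  rcases h0.eq_or_lt with h | h
  · have := hne.some_mem.2 v hv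
    rw [← h] at this ⊢
    simpa using this
  · rw [← div_le_iff₀ h]
    refine le_csInf hne fun b hb => ?_
    rw [div_le_iff₀ h]
    exact hb.2 v hv

theorem poincareConst_nonneg (Ω : Set Plane) : 0 ≤ poincareConst Ω :=
  Real.sInf_nonneg fun _ h => h.1

/-! ### Energy projections -/

/-- Every `e` has an energy projection onto each closed subspace of `H¹₀(Ω)`. -/
theorem exists_energy_projection {Ω : Set Plane} (hΩb : Bornology.IsBounded Ω)
    (S : Submodule ℝ (L2Pair Ω)) (hS : S ≤ H10 Ω Ω) (hSc : IsClosed (S : Set (L2Pair Ω)))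
    (e : L2Pair Ω) : ∃ p ∈ S, ∀ v ∈ S, energyForm p v = energyForm e v := by
  obtain ⟨c, hc, hP⟩ := exists_poincare hΩb
  let G : S →L[ℝ] Lp Plane 2 (volume.restrict Ω) :=
    (ContinuousLinearMap.snd ℝ _ _).comp S.subtypeL
  have : CompleteSpace S := hSc.completeSpace_coe
  -- By Poincaré the gradient map is bounded below on `S`, so its range is complete; projecting `∇e`
  -- orthogonally onto the range and lifting back gives the energy projection.
  have hG : AntilipschitzWith (max c 1).toNNReal G := by
    refine AddMonoidHomClass.antilipschitz_of_bound G fun x => ?_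
    have h1 := hP _ (hS x.2)
    have h2 : (0 : ℝ) ≤ ‖(x : L2Pair Ω).2‖ := norm_nonneg _
    rw [Real.coe_toNNReal _ (by positivity)]
    change max ‖(x : L2Pair Ω).1‖ ‖(x : L2Pair Ω).2‖ ≤ max c 1 * ‖(x : L2Pair Ω).2‖
    refine max_le (h1.trans ?_) ?_
    · gcongr; exact le_max_left _ _
    · exact le_mul_of_one_le_left h2 (le_max_right _ _)
  let K : Submodule ℝ (Lp Plane 2 (volume.restrict Ω)) := LinearMap.range G.toLinearMap
  have hK : IsComplete (K : Set (Lp Plane 2 (volume.restrict Ω))) :=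
    hG.isComplete_range G.uniformContinuous
  have : CompleteSpace K := hK.completeSpace_coe
  obtain ⟨p, hp⟩ := (K.orthogonalProjectionOnto e.2).2
  refine ⟨p, p.2, fun v hv => ?_⟩
  have hv2 : v.2 ∈ K := ⟨⟨v, hv⟩, rfl⟩
  have h := K.starProjection_inner_eq_zero e.2 v.2 hv2
  rw [K.starProjection_apply, ← hp, inner_sub_left, sub_eq_zero] at h
  rw [energyForm_eq_inner, energyForm_eq_inner]
  exact h.symm

/-! ### Functions in `H¹₀(D)` vanish outside `D` -/

theorem gradient_ae_eq_zero_of_mem_H10 {Ω D : Set Plane} (hD : MeasurableSet D) {v : L2Pair Ω}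
    (hv : v ∈ H10 Ω D) : ∀ᵐ x ∂volume.restrict Ω, x ∉ D → v.2 x = 0 := by
  -- Vanishing off `D` is the kernel of a continuous map, hence survives the closure.
  let R : L2Pair Ω →L[ℝ] Lp Plane 2 ((volume.restrict Ω).restrict Dᶜ) :=
    (LpToLpRestrictCLM Plane Plane ℝ (volume.restrict Ω) 2 Dᶜ).comp
      (ContinuousLinearMap.snd ℝ _ _)
  have hR (w : L2Pair Ω) : R w = 0 ↔ ∀ᵐ x ∂volume.restrict Ω, x ∈ Dᶜ → w.2 x = 0 := by
    rw [← ae_restrict_iff' hD.compl, Lp.eq_zero_iff_ae_eq_zero]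
    have h := LpToLpRestrictCLM_coeFn ℝ Dᶜ w.2
    exact ⟨fun h' => h.symm.trans h', fun h' => h.trans h'⟩
  rw [H10_eq_closure_testPairs] at hv
  refine (hR v).1 ?_
  refine closure_minimal (t := {w | R w = 0}) ?_ (isClosed_eq R.continuous continuous_const) hv
  rintro p ⟨φ, hφ, -, hp⟩
  refine (hR p).2 ?_
  filter_upwards [hp] with x hx hxD
  rw [hx, hφ.gradient_eq_zero hxD]

/-- Turns the local network errors, measured only on the subdomains, into global energy errors. -/
theorem localH1Seminorm_eq_h1Seminorm {Ω D : Set Plane} (hΩ : MeasurableSet Ω)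
    (hD : MeasurableSet D) (hDΩ : D ⊆ Ω)
    {v : L2Pair Ω} (hv : v ∈ H10 Ω D) : localH1Seminorm D v = h1Seminorm v := by
  have h := (ae_restrict_iff' hΩ).1 (gradient_ae_eq_zero_of_mem_H10 hD hv)
  rw [localH1Seminorm, h1Seminorm, energyForm]
  simp only [real_inner_self_eq_norm_sq]
  rw [setIntegral_eq_of_subset_of_ae_sdiff_eq_zero hΩ.nullMeasurableSet hDΩ]
  filter_upwards [h] with x hx hxD
  simp [hx hxD.1 hxD.2]

/-! ### Abstract additive Schwarz estimates -/

/-- Since `‖e‖² = ∑ ⟪e, vᵢ⟫ = ∑ ⟪pᵢ, vᵢ⟫`, Cauchy-Schwarz and stability give the bound after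
cancelling one `‖e‖²`. -/
theorem norm_sq_le_of_stable_decomposition {ι F : Type*} [Fintype ι] [NormedAddCommGroup F]
    [InnerProductSpace ℝ F] {e : F} {p v : ι → F} {c : ℝ} (hc₀ : 0 ≤ c)
    (hv : e = ∑ i, v i)
    (hp : ∀ i, inner ℝ (p i) (v i) = inner ℝ e (v i))
    (hc : ∑ i, ‖v i‖ ^ 2 ≤ c * ‖e‖ ^ 2) :
    ‖e‖ ^ 2 ≤ c * ∑ i, ‖p i‖ ^ 2 := by
  have hS : 0 ≤ ∑ i, ‖p i‖ ^ 2 := by positivity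
  have h1 : ‖e‖ ^ 2 ≤ ∑ i, ‖p i‖ * ‖v i‖ := by
    calc ‖e‖ ^ 2 = inner ℝ e (∑ i, v i) := by rw [← hv, real_inner_self_eq_norm_sq]
      _ = ∑ i, inner ℝ (p i) (v i) := by
          rw [inner_sum]
          exact Finset.sum_congr rfl fun i _ => (hp i).symm
      _ ≤ _ := Finset.sum_le_sum fun i _ => real_inner_le_norm _ _
  have h2 := Finset.sum_mul_sq_le_sq_mul_sq Finset.univ (fun i => ‖p i‖) (fun i => ‖v i‖)
  have h3 : (‖e‖ ^ 2) ^ 2 ≤ (∑ i, ‖p i‖ ^ 2) * (c * ‖e‖ ^ 2) :=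
    (pow_le_pow_left₀ (by positivity) h1 2).trans (h2.trans (by gcongr))
  rcases eq_or_ne e 0 with rfl | he
  · simpa using mul_nonneg hc₀ hS
  · have : 0 < ‖e‖ ^ 2 := by positivity
    refine le_of_mul_le_mul_right ?_ this
    linarith

theorem sum_mul_le_matrixTwoNorm {N : ℕ} (E : Matrix (Fin N) (Fin N) ℝ) (x : Fin N → ℝ) :
    ∑ i, ∑ j, E i j * x i * x j ≤ matrixTwoNorm E * ∑ i, x i ^ 2 := by
  set y : EuclideanSpace ℝ (Fin N) := WithLp.toLp 2 x
  have h1 : inner ℝ y (Matrix.toEuclideanCLM (𝕜 := ℝ) E y) = ∑ i, ∑ j, E i j * x i * x j := by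
    rw [Matrix.inner_toEuclideanCLM]
    simp only [dotProduct, Matrix.mulVec, Finset.mul_sum]
    refine Finset.sum_congr rfl fun i _ => Finset.sum_congr rfl fun j _ => ?_
    simp only [y]; ring
  have h2 : ‖y‖ ^ 2 = ∑ i, x i ^ 2 := by
    rw [EuclideanSpace.norm_sq_eq]; simp [y]
  rw [← h1, ← h2]
  calc _ ≤ ‖y‖ * ‖Matrix.toEuclideanCLM (𝕜 := ℝ) E y‖ := real_inner_le_norm _ _
    _ ≤ ‖y‖ * (matrixTwoNorm E * ‖y‖) := by
      gcongr; exact ContinuousLinearMap.le_opNorm _ _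
    _ = _ := by ring

/-- With `s = ∑ pᵢ`: `‖s‖² ≤ ‖E‖ ∑ ‖pᵢ‖² = ‖E‖ ⟪e, s⟫ ≤ ‖E‖ ‖e‖ ‖s‖`; cancel `‖s‖`. -/
theorem norm_sum_le_matrixTwoNorm_mul {N : ℕ} {F : Type*} [NormedAddCommGroup F]
    [InnerProductSpace ℝ F] (E : Matrix (Fin N) (Fin N) ℝ) {e : F} {p : Fin N → F}
    (hp : ∀ i, inner ℝ (p i) (p i) = inner ℝ e (p i))
    (hE : ∀ i j, inner ℝ (p i) (p j) ≤ E i j * ‖p i‖ * ‖p j‖) :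
    ‖∑ i, p i‖ ≤ matrixTwoNorm E * ‖e‖ := by
  have hE0 : 0 ≤ matrixTwoNorm E := norm_nonneg _
  have h1 : ∑ i, ‖p i‖ ^ 2 ≤ ‖e‖ * ‖∑ i, p i‖ := by
    calc ∑ i, ‖p i‖ ^ 2 = inner ℝ e (∑ i, p i) := by
          rw [inner_sum]
          exact Finset.sum_congr rfl fun i _ => by rw [← hp, real_inner_self_eq_norm_sq]
      _ ≤ _ := real_inner_le_norm _ _
  have h2 : ‖∑ i, p i‖ ^ 2 ≤ matrixTwoNorm E * ∑ i, ‖p i‖ ^ 2 := by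
    calc ‖∑ i, p i‖ ^ 2 = ∑ i, ∑ j, inner ℝ (p i) (p j) := by
          rw [← real_inner_self_eq_norm_sq, sum_inner]; simp_rw [inner_sum]
      _ ≤ ∑ i, ∑ j, E i j * ‖p i‖ * ‖p j‖ :=
          Finset.sum_le_sum fun i _ => Finset.sum_le_sum fun j _ => hE i j
      _ ≤ _ := sum_mul_le_matrixTwoNorm E _
  rcases (norm_nonneg (∑ i, p i)).eq_or_lt with h | h
  · rw [← h]; positivity
  · refine le_of_mul_le_mul_right ?_ h
    calc _ = ‖∑ i, p i‖ ^ 2 := by ring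
      _ ≤ _ := h2
      _ ≤ matrixTwoNorm E * (‖e‖ * ‖∑ i, p i‖) := by gcongr
      _ = _ := by ring

theorem norm_sub_smul_sq {F : Type*} [NormedAddCommGroup F] [InnerProductSpace ℝ F] (e q : F)
    (τ : ℝ) : ‖e - τ • q‖ ^ 2 = ‖e‖ ^ 2 - 2 * τ * inner ℝ e q + τ ^ 2 * ‖q‖ ^ 2 := by
  rw [norm_sub_sq_real, real_inner_smul_right, norm_smul, mul_pow, Real.norm_eq_abs, sq_abs]
  ring

/-! ### Overlap of the subdomains -/

theorem mem_sharing {N : ℕ} {D : Fin N → Set Plane} {x : Plane} {i : Fin N} :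
    i ∈ sharing D x ↔ x ∈ D i := by
  simp [sharing]

theorem card_sharing_le_maxOverlap {N : ℕ} {Ω : Set Plane} (D : Fin N → Set Plane) {x : Plane}
    (hx : x ∈ Ω) : (sharing D x).card ≤ maxOverlap Ω D := by
  refine le_csSup ⟨N, ?_⟩ (mem_image_of_mem _ hx)
  rintro _ ⟨y, -, rfl⟩
  simpa using Finset.card_le_univ (sharing D y)

theorem IsSubdomainCover.subset {N : ℕ} {Ω : Set Plane} {D : Fin N → Set Plane}
    (hD : IsSubdomainCover Ω D) (i : Fin N) : D i ⊆ Ω :=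
  hD.cover ▸ subset_iUnion D i

theorem IsSubdomainCover.one_le_card_sharing {N : ℕ} {Ω : Set Plane} {D : Fin N → Set Plane}
    (hD : IsSubdomainCover Ω D) {x : Plane} (hx : x ∈ Ω) : 1 ≤ (sharing D x).card := by
  rw [← hD.cover, mem_iUnion] at hx
  obtain ⟨i, hi⟩ := hx
  exact Finset.card_pos.2 ⟨i, mem_sharing.2 hi⟩

theorem norm_add_sum_sq_le {ι F : Type*} [SeminormedAddCommGroup F] (s : Finset ι) (a : F)
    (b : ι → F) : ‖a + ∑ i ∈ s, b i‖ ^ 2 ≤ (s.card + 1) * (‖a‖ ^ 2 + ∑ i ∈ s, ‖b i‖ ^ 2) := by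
  have h := sq_sum_le_card_mul_sum_sq (s := Finset.insertNone s)
    (f := fun o => o.elim ‖a‖ fun i => ‖b i‖)
  simp only [Finset.sum_insertNone, Finset.card_insertNone, Option.elim] at h
  push_cast at h
  refine (pow_le_pow_left₀ (norm_nonneg _) ?_ 2).trans h
  exact (norm_add_le _ _).trans (by gcongr; exact norm_sum_le _ _)

/-- At almost every `x` only the `q i` with `i ∈ sharing D x` survive. Cauchy-Schwarz for at most
`N_c` local terms and one coarse term is then integrated. -/
theorem norm_add_sum_sq_le_maxOverlap {N : ℕ} {Ω : Set Plane} (hΩ : MeasurableSet Ω)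
    (D : Fin N → Set Plane) (q₀ : Lp Plane 2 (volume.restrict Ω))
    (q : Fin N → Lp Plane 2 (volume.restrict Ω))
    (hq : ∀ i, ∀ᵐ x ∂volume.restrict Ω, x ∉ D i → q i x = 0) :
    ‖q₀ + ∑ i, q i‖ ^ 2 ≤ (maxOverlap Ω D + 1) * (‖q₀‖ ^ 2 + ∑ i, ‖q i‖ ^ 2) := by
  have hsq (r : Lp Plane 2 (volume.restrict Ω)) : ‖r‖ ^ 2 = ∫ x in Ω, ‖r x‖ ^ 2 := by
    rw [← real_inner_self_eq_norm_sq, L2.inner_def]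
    simp only [real_inner_self_eq_norm_sq]
  have hint (r : Lp Plane 2 (volume.restrict Ω)) :
      Integrable (fun x => ‖r x‖ ^ 2) (volume.restrict Ω) :=
    (Lp.memLp r).integrable_norm_pow two_ne_zero
  simp only [hsq]
  rw [← integral_finsetSum _ fun i _ => hint (q i),
    ← integral_add (hint q₀) (integrable_finsetSum _ fun i _ => hint (q i)),
    ← integral_const_mul]
  refine integral_mono_ae (hint _)
    (((hint q₀).add (integrable_finsetSum _ fun i _ => hint (q i))).const_mul _) ?_
  filter_upwards [Lp.coeFn_add q₀ (∑ i, q i), Lp.coeFn_finsetSum Finset.univ q,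
    ae_all_iff.2 hq, ae_restrict_mem hΩ] with x h1 h2 h3 hx
  rw [h1, Pi.add_apply, h2, Finset.sum_apply]
  have hs : ∑ i, q i x = ∑ i ∈ sharing D x, q i x :=
    (Finset.sum_subset (Finset.subset_univ _) fun i _ hi =>
      h3 i fun h => hi (mem_sharing.2 h)).symm
  rw [hs]
  refine (norm_add_sum_sq_le _ _ _).trans ?_
  gcongr
  · exact card_sharing_le_maxOverlap D hx
  · exact Finset.subset_univ _

/-! ### The additive Schwarz operator -/

/-- `q = (P₀ + ∑ᵢ Pᵢ) e`, where `P₀` and `Pᵢ` are the energy projections onto the coarse space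
and onto the local spaces. -/
def IsSchwarzCorrection {Ω : Set Plane} {N : ℕ} (D : Fin N → Set Plane)
    (V₀ : Submodule ℝ (L2Pair Ω)) (e q : L2Pair Ω) : Prop :=
  ∃ (p₀ : L2Pair Ω) (p : Fin N → L2Pair Ω),
    (p₀ ∈ V₀ ∧ ∀ v ∈ V₀, energyForm p₀ v = energyForm e v) ∧
    (∀ i, p i ∈ H10 Ω (D i) ∧ ∀ v ∈ H10 Ω (D i), energyForm (p i) v = energyForm e v) ∧
    q = p₀ + ∑ i, p i

theorem energyForm_sub_left {Ω : Set Plane} (v v' w : L2Pair Ω) :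
    energyForm (v - v') w = energyForm v w - energyForm v' w := by
  simp only [energyForm_eq_inner, Prod.snd_sub, inner_sub_left]

/-- Distributing the `N` copies of `z` over the local solutions exposes the step as a correction by
`w i - z`, which lies in the local space. -/
theorem relaxed_step_eq {F : Type*} [AddCommGroup F] [Module ℝ F] {N : ℕ} (τ : ℝ) (z w₀ : F)
    (w : Fin N → F) :
    (1 - N * τ) • z + τ • (w₀ + ∑ i, w i) = z + τ • (w₀ + ∑ i, (w i - z)) := by
  rw [Finset.sum_sub_distrib, Finset.sum_const, Finset.card_univ, Fintype.card_fin,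
    ← Nat.cast_smul_eq_nsmul ℝ]
  module

section

variable {Ω : Set Plane} {N : ℕ} {D : Fin N → Set Plane} {V₀ : Submodule ℝ (L2Pair Ω)}

theorem IsSchwarzCorrection.sub {e e' q q' : L2Pair Ω} (h : IsSchwarzCorrection D V₀ e q)
    (h' : IsSchwarzCorrection D V₀ e' q') : IsSchwarzCorrection D V₀ (e - e') (q - q') := by
  obtain ⟨p₀, p, hp₀, hp, rfl⟩ := h
  obtain ⟨p₀', p', hp₀', hp', rfl⟩ := h'
  refine ⟨p₀ - p₀', p - p', ⟨sub_mem hp₀.1 hp₀'.1, fun v hv => ?_⟩, fun i =>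
    ⟨sub_mem (hp i).1 (hp' i).1, fun v hv => ?_⟩, ?_⟩
  · rw [energyForm_sub_left, energyForm_sub_left, hp₀.2 v hv, hp₀'.2 v hv]
  · rw [Pi.sub_apply, energyForm_sub_left, energyForm_sub_left, (hp i).2 v hv, (hp' i).2 v hv]
  · simp only [Pi.sub_apply, Finset.sum_sub_distrib]
    abel

theorem IsSchwarzCorrection.mem {e q : L2Pair Ω} (h : IsSchwarzCorrection D V₀ e q)
    (hD : IsSubdomainCover Ω D) (hV₀ : V₀ ≤ H10 Ω Ω) : q ∈ H10 Ω Ω := by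
  obtain ⟨p₀, p, hp₀, hp, rfl⟩ := h
  exact add_mem (hV₀ hp₀.1) (sum_mem fun i _ => H10_mono Ω (hD.subset i) (hp i).1)

theorem IsWeakSolution.isLocalSolution_iff {f : Lp ℝ 2 (volume.restrict Ω)} {g u : L2Pair Ω}
    (hu : IsWeakSolution f g u) {D : Set Plane} (hD : D ⊆ Ω) {z w : L2Pair Ω} :
    IsLocalSolution f D z w ↔ w - z ∈ H10 Ω D ∧
      ∀ v ∈ H10 Ω D, energyForm (w - z) v = energyForm (u - z) v := by
  refine ⟨fun h => ⟨h.1, fun v hv => ?_⟩, fun h => ⟨h.1, fun v hv => ?_⟩⟩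
  · rw [energyForm_sub_left, energyForm_sub_left, h.2 v hv, hu.equation v (H10_mono Ω hD hv)]
  · have := h.2 v hv
    rw [energyForm_sub_left, energyForm_sub_left, hu.equation v (H10_mono Ω hD hv)] at this
    linarith

theorem IsWeakSolution.isCoarseSolution_iff {f : Lp ℝ 2 (volume.restrict Ω)} {g u : L2Pair Ω}
    (hu : IsWeakSolution f g u) (hV₀ : V₀ ≤ H10 Ω Ω) {z w : L2Pair Ω} :
    IsCoarseSolution f V₀ z w ↔ w ∈ V₀ ∧ ∀ v ∈ V₀, energyForm w v = energyForm (u - z) v := by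
  refine ⟨fun h => ⟨h.1, fun v hv => ?_⟩, fun h => ⟨h.1, fun v hv => ?_⟩⟩
  · rw [energyForm_sub_left, h.2 v hv, hu.equation v (hV₀ hv)]
  · rw [h.2 v hv, energyForm_sub_left, hu.equation v (hV₀ hv)]

theorem IsWeakSolution.isExactStep_iff {f : Lp ℝ 2 (volume.restrict Ω)} {g u : L2Pair Ω}
    (hu : IsWeakSolution f g u) (hD : IsSubdomainCover Ω D) (hV₀ : V₀ ≤ H10 Ω Ω) {τ : ℝ}
    {z z' : L2Pair Ω} :
    IsExactStep f D V₀ τ z z' ↔ ∃ q, IsSchwarzCorrection D V₀ (u - z) q ∧ z' = z + τ • q := by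
  constructor
  · rintro ⟨w₀, w, h₀, hw, rfl⟩
    exact ⟨_, ⟨w₀, fun i => w i - z, (hu.isCoarseSolution_iff hV₀).1 h₀,
      fun i => (hu.isLocalSolution_iff (hD.subset i)).1 (hw i), rfl⟩, relaxed_step_eq _ _ _ _⟩
  · rintro ⟨_, ⟨p₀, p, h₀, hp, rfl⟩, rfl⟩
    refine ⟨p₀, fun i => z + p i, (hu.isCoarseSolution_iff hV₀).2 h₀,
      fun i => (hu.isLocalSolution_iff (hD.subset i)).2 ?_, ?_⟩
    · simpa using hp i
    · rw [relaxed_step_eq]; simp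

/-- Every `e` in `H10 Ω Ω` is the error of the iterate `u - e`, so the factor bounds `1 - τ (P₀ + ∑
Pᵢ)` on the whole space and also applies to differences of iterates. -/
theorem IsWeakSolution.isErrorReductionFactor_iff {f : Lp ℝ 2 (volume.restrict Ω)}
    {g u : L2Pair Ω} (hu : IsWeakSolution f g u) (hD : IsSubdomainCover Ω D)
    (hV₀ : V₀ ≤ H10 Ω Ω) {τ C : ℝ} :
    IsErrorReductionFactor f D V₀ τ u C ↔ 0 ≤ C ∧ ∀ e ∈ H10 Ω Ω, ∀ q,
      IsSchwarzCorrection D V₀ e q → ‖(e - τ • q).2‖ ≤ C * ‖e.2‖ := by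
  refine and_congr_right fun _ => ⟨fun h e he q hq => ?_, fun h z z' hz hs => ?_⟩
  · have hs : IsExactStep f D V₀ τ (u - e) (u - e + τ • q) :=
      (hu.isExactStep_iff hD hV₀).2 ⟨q, by rwa [sub_sub_cancel], rfl⟩
    have := h _ _ (by rwa [sub_sub_cancel]) hs
    rwa [h1Seminorm_eq_norm, h1Seminorm_eq_norm, sub_sub_cancel,
      show u - (u - e + τ • q) = e - τ • q by abel] at this
  · obtain ⟨q, hq, rfl⟩ := (hu.isExactStep_iff hD hV₀).1 hs
    rw [h1Seminorm_eq_norm, h1Seminorm_eq_norm, ← sub_sub]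
    exact h _ hz q hq

/-! ### Bounds for the additive Schwarz operator -/

theorem IsSchwarzCorrection.norm_sq_le_inner {C₀ : ℝ} (hC₀ : 0 ≤ C₀)
    (h1 : StableDecomposition D V₀ C₀) {e q : L2Pair Ω} (he : e ∈ H10 Ω Ω)
    (h : IsSchwarzCorrection D V₀ e q) : ‖e.2‖ ^ 2 ≤ C₀ * inner ℝ e.2 q.2 := by
  obtain ⟨p₀, p, hp₀, hp, rfl⟩ := h
  obtain ⟨v₀, v, hv₀, hv, hev, hle⟩ := h1 e he
  simp only [energyForm_eq_inner] at hp₀ hp hle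
  -- The coarse space is the index `none`.
  have key := norm_sq_le_of_stable_decomposition (ι := Option (Fin N)) (e := e.2)
    (p := fun o => o.elim p₀.2 fun i => (p i).2) (v := fun o => o.elim v₀.2 fun i => (v i).2)
    hC₀ (by simpa [Fintype.sum_option, Prod.snd_sum] using congrArg Prod.snd hev)
    (by rintro (_ | i)
        · exact hp₀.2 _ hv₀
        · exact (hp i).2 _ (hv i))
    (by simpa [Fintype.sum_option, real_inner_self_eq_norm_sq] using hle)
  refine key.trans_eq ?_
  simp only [Fintype.sum_option, Option.elim, Prod.snd_add, Prod.snd_sum, inner_add_right,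
    inner_sum, ← real_inner_self_eq_norm_sq]
  rw [hp₀.2 _ hp₀.1]
  simp only [(hp _).2 _ (hp _).1]

theorem IsSchwarzCorrection.inner_nonneg {e q : L2Pair Ω} (h : IsSchwarzCorrection D V₀ e q) :
    0 ≤ inner ℝ e.2 q.2 := by
  obtain ⟨p₀, p, hp₀, hp, rfl⟩ := h
  simp only [energyForm_eq_inner] at hp₀ hp
  simp only [Prod.snd_add, Prod.snd_sum, inner_add_right, inner_sum, ← hp₀.2 _ hp₀.1,
    ← (hp _).2 _ (hp _).1, real_inner_self_eq_norm_sq]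
  positivity

theorem norm_le_of_inner_self_eq {F : Type*} [NormedAddCommGroup F] [InnerProductSpace ℝ F]
    {e p : F} (h : inner ℝ p p = inner ℝ e p) : ‖p‖ ≤ ‖e‖ := by
  rcases (norm_nonneg p).eq_or_lt with h0 | h0
  · rw [← h0]; exact norm_nonneg e
  · refine le_of_mul_le_mul_right ?_ h0
    rw [← real_inner_self_eq_norm_mul_norm, h]
    exact real_inner_le_norm _ _

theorem IsSchwarzCorrection.norm_sq_le_matrixTwoNorm {E : Matrix (Fin N) (Fin N) ℝ}
    (h2 : StrengthenedCauchySchwarz Ω D E) {e q : L2Pair Ω}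
    (h : IsSchwarzCorrection D V₀ e q) :
    ‖q.2‖ ^ 2 ≤ 2 * (matrixTwoNorm E ^ 2 + 1) * ‖e.2‖ ^ 2 := by
  obtain ⟨p₀, p, hp₀, hp, rfl⟩ := h
  simp only [energyForm_eq_inner] at hp₀ hp
  have h0 : ‖p₀.2‖ ≤ ‖e.2‖ := norm_le_of_inner_self_eq (hp₀.2 _ hp₀.1)
  have hS : ‖∑ i, (p i).2‖ ≤ matrixTwoNorm E * ‖e.2‖ :=
    norm_sum_le_matrixTwoNorm_mul E (fun i => (hp i).2 _ (hp i).1) fun i j => by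
      have := (h2 i j).2.2 _ (hp i).1 _ (hp j).1
      rw [← h1Seminorm, ← h1Seminorm] at this
      rwa [h1Seminorm_eq_norm, h1Seminorm_eq_norm, energyForm_eq_inner] at this
  rw [Prod.snd_add, Prod.snd_sum]
  have h3 := pow_le_pow_left₀ (norm_nonneg _) (norm_add_le p₀.2 (∑ i, (p i).2)) 2
  have h4 := pow_le_pow_left₀ (norm_nonneg _) h0 2
  have h5 := pow_le_pow_left₀ (norm_nonneg _) hS 2
  have h6 := sq_nonneg (‖p₀.2‖ - ‖∑ i, (p i).2‖)
  nlinarith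

theorem IsSchwarzCorrection.norm_sq_le_maxOverlap (hΩ : MeasurableSet Ω)
    (hD : ∀ i, MeasurableSet (D i)) {e q : L2Pair Ω} (h : IsSchwarzCorrection D V₀ e q) :
    ‖q.2‖ ^ 2 ≤ (maxOverlap Ω D + 1) * inner ℝ e.2 q.2 := by
  obtain ⟨p₀, p, hp₀, hp, rfl⟩ := h
  have key := norm_add_sum_sq_le_maxOverlap hΩ D p₀.2 (fun i => (p i).2)
    fun i => gradient_ae_eq_zero_of_mem_H10 (hD i) (hp i).1
  simp only [energyForm_eq_inner] at hp₀ hp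
  rw [Prod.snd_add, Prod.snd_sum]
  refine key.trans_eq ?_
  simp only [inner_add_right, inner_sum, ← hp₀.2 _ hp₀.1, ← (hp _).2 _ (hp _).1,
    real_inner_self_eq_norm_sq]

theorem exists_energy_projections (hΩb : Bornology.IsBounded Ω) (hD : IsSubdomainCover Ω D)
    (hV₀ : V₀ ≤ H10 Ω Ω) (hV₀c : IsClosed (V₀ : Set (L2Pair Ω))) (e : L2Pair Ω) :
    ∃ (p₀ : L2Pair Ω) (p : Fin N → L2Pair Ω),
      (p₀ ∈ V₀ ∧ ∀ v ∈ V₀, energyForm p₀ v = energyForm e v) ∧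
      (∀ i, p i ∈ H10 Ω (D i) ∧ ∀ v ∈ H10 Ω (D i), energyForm (p i) v = energyForm e v) := by
  obtain ⟨p₀, hp₀⟩ := exists_energy_projection hΩb V₀ hV₀ hV₀c e
  choose p hp using fun i =>
    exists_energy_projection hΩb (H10 Ω (D i)) (H10_mono Ω (hD.subset i)) (isClosed_H10 Ω _) e
  exact ⟨p₀, p, hp₀, hp⟩

/-! ### Error reduction -/

theorem norm_le_sqrt_mul_of_sq_le {a b R : ℝ} (hb : 0 ≤ b)
    (h : a ^ 2 ≤ R * b ^ 2) : a ≤ Real.sqrt R * b := by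
  rw [← Real.sqrt_sq hb, ← Real.sqrt_mul' _ (sq_nonneg b)]
  exact Real.le_sqrt_of_sq_le h

theorem isErrorReductionFactor_sqrt_reductionBound {f : Lp ℝ 2 (volume.restrict Ω)}
    {g u : L2Pair Ω} (hu : IsWeakSolution f g u) (hD : IsSubdomainCover Ω D)
    (hV₀ : V₀ ≤ H10 Ω Ω) {τ : ℝ} (hτ : 0 < τ) {C₀ : ℝ} (hC₀ : 0 ≤ C₀)
    (h1 : StableDecomposition D V₀ C₀) {E : Matrix (Fin N) (Fin N) ℝ}
    (h2 : StrengthenedCauchySchwarz Ω D E) :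
    IsErrorReductionFactor f D V₀ τ u (Real.sqrt (reductionBound C₀ (matrixTwoNorm E) τ)) := by
  refine (hu.isErrorReductionFactor_iff hD hV₀).2 ⟨Real.sqrt_nonneg _, fun e he q hq => ?_⟩
  refine norm_le_sqrt_mul_of_sq_le (norm_nonneg _) ?_
  rw [Prod.snd_sub, Prod.smul_snd, norm_sub_smul_sq, reductionBound]
  have hA := hq.norm_sq_le_inner hC₀ h1 he
  have hB := hq.norm_sq_le_matrixTwoNorm h2
  have hA0 := hq.inner_nonneg
  -- Weakening `C₀` to `2 + C₀` is allowed because the inner product is nonnegative, and it keeps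
  -- the divisor positive.
  have hA' : ‖e.2‖ ^ 2 / (2 + C₀) ≤ inner ℝ e.2 q.2 := by
    rw [div_le_iff₀ (by positivity)]; linarith
  calc _ ≤ ‖e.2‖ ^ 2 - 2 * τ * (‖e.2‖ ^ 2 / (2 + C₀)) +
        τ ^ 2 * (2 * (matrixTwoNorm E ^ 2 + 1) * ‖e.2‖ ^ 2) := by gcongr
    _ = _ := by ring

theorem exists_isErrorReductionFactor_lt_one {f : Lp ℝ 2 (volume.restrict Ω)}
    {g u : L2Pair Ω} (hu : IsWeakSolution f g u) (hD : IsSubdomainCover Ω D)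
    (hV₀ : V₀ ≤ H10 Ω Ω) {τ : ℝ} (hτ : 0 < τ) (hτN : τ ≤ 1 / (maxOverlap Ω D : ℝ))
    (hN : 2 ≤ maxOverlap Ω D) {C₀ : ℝ} (hC₀ : 0 ≤ C₀) (h1 : StableDecomposition D V₀ C₀) :
    ∃ C₂ < 1, IsErrorReductionFactor f D V₀ τ u C₂ := by
  have hN' : (2 : ℝ) ≤ maxOverlap Ω D := by exact_mod_cast hN
  have hΩ : IsOpen Ω := hD.cover ▸ isOpen_iUnion hD.isOpen
  refine ⟨Real.sqrt (1 - τ / (2 * (2 + C₀))), ?_, ?_⟩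
  · rw [Real.sqrt_lt' one_pos]
    have : 0 < τ / (2 * (2 + C₀)) := by positivity
    linarith
  refine (hu.isErrorReductionFactor_iff hD hV₀).2 ⟨Real.sqrt_nonneg _, fun e he q hq => ?_⟩
  refine norm_le_sqrt_mul_of_sq_le (norm_nonneg _) ?_
  rw [Prod.snd_sub, Prod.smul_snd, norm_sub_smul_sq]
  have hA := hq.norm_sq_le_inner hC₀ h1 he
  have hB := hq.norm_sq_le_maxOverlap hΩ.measurableSet fun i => (hD.isOpen i).measurableSet
  have hA0 := hq.inner_nonneg
  have hA' : ‖e.2‖ ^ 2 / (2 + C₀) ≤ inner ℝ e.2 q.2 := by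
    rw [div_le_iff₀ (by positivity)]; linarith
  -- From `τ N_c ≤ 1` and `N_c ≥ 2`, also `τ ≤ 1/2`. The remaining `2 - 3/2 = 1/2` is the source of
  -- the factor `τ / (2 (2 + C₀))`.
  have hτ1 : τ * (maxOverlap Ω D + 1) ≤ 3 / 2 := by
    rw [le_div_iff₀ (by positivity)] at hτN
    nlinarith
  calc _ ≤ ‖e.2‖ ^ 2 - 2 * τ * inner ℝ e.2 q.2 +
        τ ^ 2 * ((maxOverlap Ω D + 1) * inner ℝ e.2 q.2) := by gcongr
    _ = ‖e.2‖ ^ 2 - τ * (2 - τ * (maxOverlap Ω D + 1)) * inner ℝ e.2 q.2 := by ring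
    _ ≤ ‖e.2‖ ^ 2 - τ * (1 / 2) * (‖e.2‖ ^ 2 / (2 + C₀)) := by
      gcongr
      · exact mul_nonneg hτ.le (by linarith)
      · linarith
    _ = _ := by field_simp

/-! ### The network iteration -/

theorem IsNetworkIteration.sub_iterate_mem {τ : ℝ} {Θ : Fin N → Type*} {Θ₀ : Type*}
    {Unet : (i : Fin N) → Θ i → Plane → ℝ} {Wnet : Θ₀ → Plane → ℝ} {θ : ℕ → (i : Fin N) → Θ i}
    {θ₀ : ℕ → Θ₀} {U : ℕ → L2Pair Ω} {Uloc : ℕ → Fin N → L2Pair Ω} {W : ℕ → L2Pair Ω}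
    (hU : IsNetworkIteration D τ Unet Wnet θ θ₀ U Uloc W) (hD : IsSubdomainCover Ω D)
    {u : L2Pair Ω} (h0 : u - U 0 ∈ H10 Ω Ω) (n : ℕ) : u - U n ∈ H10 Ω Ω := by
  induction n with
  | zero => exact h0
  | succ n ih =>
    rw [hU.step, relaxed_step_eq, ← sub_sub]
    exact sub_mem ih (Submodule.smul_mem _ _ (add_mem (hU.coarse_boundary n)
      (sum_mem fun i _ => H10_mono Ω (hD.subset i) (hU.local_boundary n i))))

theorem sub_mem_of_isExactStep {f : Lp ℝ 2 (volume.restrict Ω)} {g u : L2Pair Ω}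
    (hu : IsWeakSolution f g u) (hD : IsSubdomainCover Ω D) (hV₀ : V₀ ≤ H10 Ω Ω) {τ : ℝ}
    {z : ℕ → L2Pair Ω} (hz : ∀ n, IsExactStep f D V₀ τ (z n) (z (n + 1)))
    (h0 : u - z 0 ∈ H10 Ω Ω) (n : ℕ) : u - z n ∈ H10 Ω Ω := by
  induction n with
  | zero => exact h0
  | succ n ih =>
    obtain ⟨q, hq, h⟩ := (hu.isExactStep_iff hD hV₀).1 (hz n)
    rw [h, ← sub_sub]
    exact sub_mem ih (Submodule.smul_mem _ _ (hq.mem hD hV₀))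

/-- A step of the network iteration differs from the exact step by at most `τ (ε₀ + ε)`. -/
theorem IsNetworkIteration.exists_correction {τ : ℝ} {Θ : Fin N → Type*} {Θ₀ : Type*}
    {Unet : (i : Fin N) → Θ i → Plane → ℝ} {Wnet : Θ₀ → Plane → ℝ} {θ : ℕ → (i : Fin N) → Θ i}
    {θ₀ : ℕ → Θ₀} {U : ℕ → L2Pair Ω} {Uloc : ℕ → Fin N → L2Pair Ω} {W : ℕ → L2Pair Ω}
    (hU : IsNetworkIteration D τ Unet Wnet θ θ₀ U Uloc W) (hD : IsSubdomainCover Ω D)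
    (hΩb : Bornology.IsBounded Ω) (hΩne : Ω.Nonempty)
    {f : Lp ℝ 2 (volume.restrict Ω)} {g u : L2Pair Ω}
    (hu : IsWeakSolution f g u) (hV₀ : V₀ ≤ H10 Ω Ω) (hV₀c : IsClosed (V₀ : Set (L2Pair Ω)))
    (hτ : 0 < τ) {ε ε₀ : ℝ} (h3 : LocalNetworkError f D U Uloc ε)
    (h3' : CoarseNetworkError f V₀ U W ε₀) (n : ℕ) :
    0 ≤ ε₀ + ε ∧ ∃ q, IsSchwarzCorrection D V₀ (u - U n) q ∧
      ‖(U n + τ • q - U (n + 1)).2‖ ≤ τ * (ε₀ + ε) := by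
  have hΩ : IsOpen Ω := hD.cover ▸ isOpen_iUnion hD.isOpen
  have hN : (N : ℝ) ≠ 0 := by
    obtain ⟨x, hx⟩ := hΩne
    rw [← hD.cover, mem_iUnion] at hx
    obtain ⟨i, -⟩ := hx
    exact_mod_cast (Fin.pos i).ne'
  obtain ⟨p₀, p, hp₀, hp⟩ := exists_energy_projections hΩb hD hV₀ hV₀c (u - U n)
  have h₀ := h3' n p₀ ((hu.isCoarseSolution_iff hV₀).2 hp₀)
  rw [h1Seminorm_eq_norm] at h₀
  have hloc (i) : ‖(p i - (Uloc (n + 1) i - U n)).2‖ ≤ ε / N := by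
    have h := h3 n i (U n + p i) ((hu.isLocalSolution_iff (hD.subset i)).2 (by simpa using hp i))
    have he : U n + p i - Uloc (n + 1) i = p i - (Uloc (n + 1) i - U n) := by abel
    rwa [he, localH1Seminorm_eq_h1Seminorm hΩ.measurableSet (hD.isOpen i).measurableSet
      (hD.subset i) (sub_mem (hp i).1 (hU.local_boundary n i)), h1Seminorm_eq_norm] at h
  have hsum : ‖(p₀ - W (n + 1)).2 + ∑ i, (p i - (Uloc (n + 1) i - U n)).2‖ ≤ ε₀ + ε := by
    refine (norm_add_le _ _).trans (add_le_add h₀ ?_)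
    refine (norm_sum_le_of_le _ fun i _ => hloc i).trans_eq ?_
    rw [Finset.sum_const, Finset.card_univ, Fintype.card_fin, nsmul_eq_mul]
    field_simp
  -- No sign of `ε` or `ε₀` is assumed; nonnegativity of their sum comes from the norm it bounds.
  refine ⟨(norm_nonneg _).trans hsum, p₀ + ∑ i, p i, ⟨p₀, p, hp₀, hp, rfl⟩, ?_⟩
  have heq : U n + τ • (p₀ + ∑ i, p i) - U (n + 1) =
      τ • (p₀ - W (n + 1) + ∑ i, (p i - (Uloc (n + 1) i - U n))) := by
    rw [hU.step, relaxed_step_eq, Finset.sum_sub_distrib (f := p)]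
    module
  rw [heq, Prod.smul_snd, norm_smul, Real.norm_of_nonneg hτ.le, Prod.snd_add, Prod.snd_sum]
  gcongr

/-- The network iteration stays close to the exact iteration. -/
theorem IsNetworkIteration.norm_sub_le {τ : ℝ} {Θ : Fin N → Type*} {Θ₀ : Type*}
    {Unet : (i : Fin N) → Θ i → Plane → ℝ} {Wnet : Θ₀ → Plane → ℝ} {θ : ℕ → (i : Fin N) → Θ i}
    {θ₀ : ℕ → Θ₀} {U : ℕ → L2Pair Ω} {Uloc : ℕ → Fin N → L2Pair Ω} {W : ℕ → L2Pair Ω}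
    (hU : IsNetworkIteration D τ Unet Wnet θ θ₀ U Uloc W) (hD : IsSubdomainCover Ω D)
    (hΩb : Bornology.IsBounded Ω) (hΩne : Ω.Nonempty)
    {f : Lp ℝ 2 (volume.restrict Ω)} {g u : L2Pair Ω}
    (hu : IsWeakSolution f g u) (hV₀ : V₀ ≤ H10 Ω Ω) (hV₀c : IsClosed (V₀ : Set (L2Pair Ω)))
    (hτ : 0 < τ) (hτ1 : τ ≤ 1) {ε ε₀ : ℝ} (h3 : LocalNetworkError f D U Uloc ε)
    (h3' : CoarseNetworkError f V₀ U W ε₀) {z : ℕ → L2Pair Ω}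
    (hz : ∀ n, IsExactStep f D V₀ τ (z n) (z (n + 1))) (hz0 : z 0 = U 0)
    (h0 : u - U 0 ∈ H10 Ω Ω) {C₂ : ℝ} (hC : IsErrorReductionFactor f D V₀ τ u C₂)
    (hC1 : C₂ < 1) (n : ℕ) : ‖(z n - U n).2‖ ≤ 1 / (1 - C₂) * (ε₀ + ε) := by
  have hpos : 0 < 1 - C₂ := sub_pos.2 hC1
  induction n with
  | zero =>
    have := (hU.exists_correction hD hΩb hΩne hu hV₀ hV₀c hτ h3 h3' 0).1
    rw [hz0, sub_self, Prod.snd_zero, norm_zero]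
    positivity
  | succ n ih =>
    obtain ⟨hε, q, hq, hle⟩ := hU.exists_correction hD hΩb hΩne hu hV₀ hV₀c hτ h3 h3' n
    obtain ⟨r, hr, hzr⟩ := (hu.isExactStep_iff hD hV₀).1 (hz n)
    -- By linearity the two corrections differ by the correction of `(u - U n) - (u - z n)`.
    have hcorr : IsSchwarzCorrection D V₀ (z n - U n) (q - r) := by
      simpa using hq.sub hr
    have hmem : z n - U n ∈ H10 Ω Ω := by
      simpa using sub_mem (hU.sub_iterate_mem hD h0 n)
        (sub_mem_of_isExactStep hu hD hV₀ hz (hz0 ▸ h0) n)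
    have hred := ((hu.isErrorReductionFactor_iff hD hV₀).1 hC).2 _ hmem _ hcorr
    have heq : z (n + 1) - U (n + 1) =
        (z n - U n - τ • (q - r)) + (U n + τ • q - U (n + 1)) := by
      rw [hzr]; module
    rw [heq, Prod.snd_add]
    -- With `τ ≤ 1`, the bound `(ε₀ + ε) / (1 - C₂)` is the fixed point of `t ↦ C₂ t + (ε₀ + ε)`.
    calc _ ≤ C₂ * ‖(z n - U n).2‖ + τ * (ε₀ + ε) :=
          (norm_add_le _ _).trans (add_le_add hred hle)
      _ ≤ C₂ * (1 / (1 - C₂) * (ε₀ + ε)) + 1 * (ε₀ + ε) := by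
          gcongr; exact hC.1
      _ = _ := by field_simp; ring

/-! ### The averaged output -/

/-- If `b = (1 - k τ) c + k τ m` with the average `m = S / k`, then `m` is controlled by `b` and `c`. -/
theorem abs_sub_averaged_le {k τ a b c : ℝ} (hk : 1 ≤ k) (hτ : 0 < τ) (hkτ : k * τ ≤ 1) {S : ℝ}
    (hb : b = c + τ * (S - k * c)) :
    |a - 1 / k * S| ≤ τ⁻¹ * (|a - b| + |a - c|) := by
  have hk0 : 0 < k := by linarith
  -- The update solved for the average; the weights `k⁻¹` and `1 - k τ` both lie in `[0, 1]`.
  have heq : a - 1 / k * S = τ⁻¹ * (k⁻¹ * ((a - b) - (1 - k * τ) * (a - c))) := by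
    rw [hb]; field_simp; ring
  rw [heq, abs_mul, abs_of_pos (inv_pos.2 hτ)]
  gcongr
  rw [abs_mul, abs_of_pos (inv_pos.2 hk0)]
  calc _ ≤ 1 * |(a - b) - (1 - k * τ) * (a - c)| := by gcongr; exact inv_le_one_of_one_le₀ hk
    _ ≤ |a - b| + |(1 - k * τ) * (a - c)| := by rw [one_mul]; exact abs_sub _ _
    _ ≤ |a - b| + 1 * |a - c| := by
      rw [abs_mul, abs_of_nonneg (by linarith : 0 ≤ 1 - k * τ)]
      gcongr
      have : 0 < k * τ := by positivity
      linarith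
    _ = _ := by rw [one_mul]

theorem IsNetworkIteration.ae_abs_sub_averagedOutput_le {τ : ℝ} {Θ : Fin N → Type*} {Θ₀ : Type*}
    {Unet : (i : Fin N) → Θ i → Plane → ℝ} {Wnet : Θ₀ → Plane → ℝ} {θ : ℕ → (i : Fin N) → Θ i}
    {θ₀ : ℕ → Θ₀} {U : ℕ → L2Pair Ω} {Uloc : ℕ → Fin N → L2Pair Ω} {W : ℕ → L2Pair Ω}
    (hU : IsNetworkIteration D τ Unet Wnet θ θ₀ U Uloc W) (hD : IsSubdomainCover Ω D)
    (hτ : 0 < τ) (hτN : τ ≤ 1 / (maxOverlap Ω D : ℝ)) (u : L2Pair Ω) (n : ℕ) :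
    ∀ᵐ x ∂volume.restrict Ω,
      |u.1 x - averagedOutput D (Wnet (θ₀ (n + 1))) (fun i => Unet i (θ (n + 1) i)) x| ≤
        τ⁻¹ * (|(u - U (n + 1)).1 x| + |(u - U n).1 x|) := by
  have hΩ : MeasurableSet Ω := (hD.cover ▸ isOpen_iUnion hD.isOpen : IsOpen Ω).measurableSet
  have hin (i) : ∀ᵐ x ∂volume.restrict Ω, x ∈ D i →
      (Uloc (n + 1) i).1 x = Unet i (θ (n + 1) i) x :=
    ae_restrict_of_ae ((ae_restrict_iff' (hD.isOpen i).measurableSet).1 (hU.local_inside n i))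
  have hout (i) : ∀ᵐ x ∂volume.restrict Ω, x ∉ D i → (Uloc (n + 1) i).1 x = (U n).1 x := by
    filter_upwards [ae_restrict_of_ae ((ae_restrict_iff'
      (hΩ.diff (hD.isOpen i).measurableSet)).1 (hU.local_outside n i)), ae_restrict_mem hΩ]
      with x hx hxΩ hxD using hx ⟨hxΩ, hxD⟩
  have hstep : (U (n + 1)).1 =
      (U n).1 + τ • ((W (n + 1)).1 + ∑ i, ((Uloc (n + 1) i).1 - (U n).1)) := by
    rw [hU.step, relaxed_step_eq]
    simp only [Prod.fst_add, Prod.smul_fst, Prod.fst_sum, Prod.fst_sub]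
  have hstep' : ∀ᵐ x ∂volume.restrict Ω, (U (n + 1)).1 x =
      (U n).1 x + τ * ((W (n + 1)).1 x + ∑ i, ((Uloc (n + 1) i).1 x - (U n).1 x)) := by
    rw [hstep]
    filter_upwards [Lp.coeFn_add (U n).1
        (τ • ((W (n + 1)).1 + ∑ i, ((Uloc (n + 1) i).1 - (U n).1))),
      Lp.coeFn_smul τ ((W (n + 1)).1 + ∑ i, ((Uloc (n + 1) i).1 - (U n).1)),
      Lp.coeFn_add (W (n + 1)).1 (∑ i, ((Uloc (n + 1) i).1 - (U n).1)),
      Lp.coeFn_finsetSum Finset.univ (fun i => (Uloc (n + 1) i).1 - (U n).1),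
      ae_all_iff.2 fun i => Lp.coeFn_sub (Uloc (n + 1) i).1 (U n).1] with x h1 h2 h3 h4 h5
    rw [h1, Pi.add_apply, h2, Pi.smul_apply, h3, Pi.add_apply, h4, Finset.sum_apply, smul_eq_mul]
    simp only [h5, Pi.sub_apply]
  filter_upwards [ae_all_iff.2 hin, ae_all_iff.2 hout, hstep', hU.coarse_eq n,
    ae_restrict_mem hΩ, Lp.coeFn_sub u.1 (U (n + 1)).1, Lp.coeFn_sub u.1 (U n).1]
    with x h1 h2 h3 h4 hx h5 h6
  rw [Prod.fst_sub, Prod.fst_sub, h5, h6, Pi.sub_apply, Pi.sub_apply, averagedOutput]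
  have hc1 : (1 : ℝ) ≤ (sharing D x).card := by exact_mod_cast hD.one_le_card_sharing hx
  have hc2 : ((sharing D x).card : ℝ) ≤ maxOverlap Ω D := by
    exact_mod_cast card_sharing_le_maxOverlap D hx
  have hpos : (0 : ℝ) < maxOverlap Ω D := by linarith
  refine abs_sub_averaged_le hc1 hτ ?_ ?_
  · rw [le_div_iff₀ hpos] at hτN
    nlinarith
  · rw [h3, h4]
    have hs : ∑ i, ((Uloc (n + 1) i).1 x - (U n).1 x) =
        ∑ i ∈ sharing D x, (Unet i (θ (n + 1) i) x - (U n).1 x) := by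
      rw [← Finset.sum_subset (Finset.subset_univ (sharing D x)) fun i _ hi => by
        rw [h2 i fun h => hi (mem_sharing.2 h), sub_self]]
      exact Finset.sum_congr rfl fun i hi => by rw [h1 i (mem_sharing.1 hi)]
    rw [hs, Finset.sum_sub_distrib, Finset.sum_const, nsmul_eq_mul]
    ring

/-- `F` is a plain function because the network families are arbitrary; monotonicity of `eLpNorm`
requires no measurability of it. -/
theorem eLpNorm_le_of_ae_abs_le {α : Type*} [MeasurableSpace α] {μ : Measure α} {c : ℝ}
    (hc : 0 ≤ c) (F : α → ℝ) (A B : Lp ℝ 2 μ) (h : ∀ᵐ x ∂μ, |F x| ≤ c * (|A x| + |B x|)) :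
    eLpNorm F 2 μ ≤ ENNReal.ofReal (c * (‖A‖ + ‖B‖)) := by
  have h1 : eLpNorm F 2 μ ≤ eLpNorm (c • (|A| + |B|) : Lp ℝ 2 μ) 2 μ := by
    refine eLpNorm_mono_ae ?_
    filter_upwards [h, Lp.coeFn_smul c (|A| + |B|), Lp.coeFn_add |A| |B|, Lp.coeFn_abs A,
      Lp.coeFn_abs B] with x hx h1 h2 h3 h4
    rw [h1, Pi.smul_apply, h2, Pi.add_apply, h3, h4, smul_eq_mul]
    exact hx.trans (le_abs_self _)
  refine h1.trans ?_
  rw [← Lp.enorm_def, ← ofReal_norm]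
  refine ENNReal.ofReal_le_ofReal ?_
  rw [norm_smul, Real.norm_of_nonneg hc]
  gcongr
  refine (norm_add_le _ _).trans_eq ?_
  rw [norm_abs_eq_norm, norm_abs_eq_norm]

end

/-! ### Error reduction factors and the error bound for the averaged output -/

theorem theorem4 {N : ℕ} {Ω : Set Plane}
    (hΩ : IsOpen Ω) (hΩb : Bornology.IsBounded Ω) (hΩne : Ω.Nonempty)
    (D : Fin N → Set Plane) (hD : IsSubdomainCover Ω D)
    -- the model problem and its solution
    (f : Lp ℝ 2 (volume.restrict Ω)) (g : L2Pair Ω) (hg : g ∈ H1 Ω)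
    (u : L2Pair Ω) (hu : IsWeakSolution f g u)
    -- the coarse space, a Hilbert subspace of `H¹₀(Ω)`
    (V₀ : Submodule ℝ (L2Pair Ω)) (hV₀ : V₀ ≤ H10 Ω Ω)
    (hV₀c : IsClosed (V₀ : Set (L2Pair Ω)))
    -- the relaxation parameter
    (τ : ℝ) (hτ : 0 < τ) (hτN : τ ≤ 1 / (maxOverlap Ω D : ℝ))
    -- the two iterations with the same initial guess
    (uH : ℕ → L2Pair Ω) (huH : ∀ n, IsExactStep f D V₀ τ (uH n) (uH (n + 1)))
    {Θ : Fin N → Type*} {Θ₀ : Type*} (Unet : (i : Fin N) → Θ i → Plane → ℝ)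
    (Wnet : Θ₀ → Plane → ℝ) (θ : ℕ → (i : Fin N) → Θ i) (θ₀ : ℕ → Θ₀)
    (U : ℕ → L2Pair Ω) (Uloc : ℕ → Fin N → L2Pair Ω) (W : ℕ → L2Pair Ω)
    (hU : IsNetworkIteration D τ Unet Wnet θ θ₀ U Uloc W)
    (hinit : uH 0 = U 0) (hinit_bd : U 0 - g ∈ H10 Ω Ω)
    -- the assumptions
    (C₀ : ℝ) (hC₀ : 0 ≤ C₀) (h1 : StableDecomposition D V₀ C₀)
    (E : Matrix (Fin N) (Fin N) ℝ) (h2 : StrengthenedCauchySchwarz Ω D E)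
    (ε ε₀ : ℝ) (h3 : LocalNetworkError f D U Uloc ε) (h3' : CoarseNetworkError f V₀ U W ε₀)
    (C : ℝ) (h4 : CoarseApproximation D V₀ C) :
    IsErrorReductionFactor f D V₀ τ u (Real.sqrt (reductionBound C₀ (matrixTwoNorm E) τ)) ∧
    (2 ≤ maxOverlap Ω D → ∃ C₂ < 1, IsErrorReductionFactor f D V₀ τ u C₂) ∧
    ∀ C₂ : ℝ, IsErrorReductionFactor f D V₀ τ u C₂ → C₂ < 1 → ∀ n : ℕ,
      eLpNorm (fun x => u.1 x - averagedOutput D (Wnet (θ₀ (n + 1)))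
          (fun i => Unet i (θ (n + 1) i)) x) 2 (volume.restrict Ω) ≤
        ENNReal.ofReal (poincareConst Ω / τ *
          (h1Seminorm (u - uH (n + 1)) + h1Seminorm (u - uH n) + 2 / (1 - C₂) * (ε₀ + ε))) := by
  refine ⟨isErrorReductionFactor_sqrt_reductionBound hu hD hV₀ hτ hC₀ h1 h2,
    fun hN => exists_isErrorReductionFactor_lt_one hu hD hV₀ hτ hτN hN hC₀ h1,
    fun C₂ hC hC1 n => ?_⟩
  have hτ1 : τ ≤ 1 := by
    obtain ⟨x, hx⟩ := hΩne
    have : (1 : ℝ) ≤ maxOverlap Ω D := by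
      exact_mod_cast (hD.one_le_card_sharing hx).trans (card_sharing_le_maxOverlap D hx)
    exact hτN.trans (div_le_one_of_le₀ this (by positivity))
  have h0 : u - U 0 ∈ H10 Ω Ω := by simpa using sub_mem hu.boundary hinit_bd
  have hP := poincareConst_nonneg Ω
  have herr (m : ℕ) : ‖(u - U m).1‖ ≤
      poincareConst Ω * (h1Seminorm (u - uH m) + 1 / (1 - C₂) * (ε₀ + ε)) := by
    refine (l2Norm_le_poincareConst_mul hΩb (hU.sub_iterate_mem hD h0 m)).trans ?_
    gcongr
    rw [h1Seminorm_eq_norm, h1Seminorm_eq_norm, ← sub_add_sub_cancel u (uH m) (U m),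
      Prod.snd_add]
    exact (norm_add_le _ _).trans (by
      gcongr
      exact hU.norm_sub_le hD hΩb hΩne hu hV₀ hV₀c hτ hτ1 h3 h3' huH hinit h0 hC hC1 m)
  refine (eLpNorm_le_of_ae_abs_le (inv_nonneg.2 hτ.le) _ (u - U (n + 1)).1 (u - U n).1
    (hU.ae_abs_sub_averagedOutput_le hD hτ hτN u n)).trans (ENNReal.ofReal_le_ofReal ?_)
  -- The iterates `n + 1` and `n` each contribute one `1 / (1 - C₂)`, hence the factor 2.
  calc _ ≤ τ⁻¹ * (poincareConst Ω * (h1Seminorm (u - uH (n + 1)) + 1 / (1 - C₂) * (ε₀ + ε)) +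
        poincareConst Ω * (h1Seminorm (u - uH n) + 1 / (1 - C₂) * (ε₀ + ε))) := by
        gcongr <;> exact herr _
    _ = _ := by ring
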